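/- For $x,y\in\mathbb{R}^2$ write $x\prec y$ if $x_1<y_1$ and $x_2<y_2$. Let $X^{(1)},X^{(2)},\dots$ be independent random vectors, each uniformly distributed in $(0,1)^2$. Say that $X^{(n)}$ is a (Pareto) record if there is no $i$ with $1\le i<n$ and $X^{(i)}\prec X^{(n)}$. For $1\le j\le n$, say that $X^{(j)}$ is a current record at time $n$ if there is no $i$ with $1\le i\le n$ and $X^{(i)}\prec X^{(j)}$. Let $K_n=-1$ if $X^{(n)}$ is not a record; otherwise let $K_n$ be the number of indices $j$ with $1\le j<n$ such that $X^{(j)}$ is a current record at time $n-1$ but is not a current record at time $n$. Then $\mathbb{P}(K_n\ge 0)>0$ for every $n\ge1$ and, as $n\to\infty$, $K_n$ conditionally given $K_n\ge 0$ converges in distribution to $G-1$, where $G$ has the Geometric$(1/2)$ distribution on $\{1,2,\dots\}$, i.e. $\mathbb{P}(G=k+1)=2^{-(k+1)}$ for $k=0,1,2,\dots$. Equivalently, for each fixed integer $k\ge 0$, \[ \mathbb{P}(K_n=k\mid K_n\ge 0)\longrightarrow 2^{-(k+1)}\qquad (n\to\infty). \] -/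

import Mathlib

open MeasureTheory ProbabilityTheory Filter Topology

namespace ParetoRecords

/-- `p ≺ q`: strict inequality in both coordinates. -/
def Dominates (p q : ℝ × ℝ) : Prop := p.1 < q.1 ∧ p.2 < q.2

/-- The observation arriving at time `n` is a (Pareto) record: `x n ⊁ x i` for `1 ≤ i < n`.
Observations arrive at times `1, 2, …`; the value `x 0` is never used. -/
def IsRecord (x : ℕ → ℝ × ℝ) (n : ℕ) : Prop :=
  ∀ i, 1 ≤ i → i < n → ¬ Dominates (x i) (x n)

/-- For `1 ≤ j ≤ n`: the `j`-th observation is a current (remaining) record at time `n`. -/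
def IsCurrentRecord (x : ℕ → ℝ × ℝ) (j n : ℕ) : Prop :=
  ∀ i, 1 ≤ i → i ≤ n → ¬ Dominates (x i) (x j)

open Classical in
/-- The number of `j` with `1 ≤ j < n` such that the `j`-th observation is a current record at
time `n - 1` but not at time `n`. -/
noncomputable def numKilled (x : ℕ → ℝ × ℝ) (n : ℕ) : ℕ :=
  ((Finset.Ico 1 n).filter
    (fun j => IsCurrentRecord x j (n - 1) ∧ ¬ IsCurrentRecord x j n)).card

open Classical in
/-- `K_n`: it is `-1` if the `n`-th observation is not a record, and otherwise the number of
remaining records that the `n`-th observation kills. -/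
noncomputable def K (x : ℕ → ℝ × ℝ) (n : ℕ) : ℤ :=
  if IsRecord x n then (numKilled x n : ℤ) else -1

/-- `G` has the Geometric(`p`) distribution on `{1, 2, …}`:
`P(G = k + 1) = (1 - p) ^ k * p` for every `k ≥ 0`. -/
def IsGeometric {Ω : Type*} [MeasurableSpace Ω] (p : ℝ) (G : Ω → ℕ) (Q : Measure Ω) : Prop :=
  Measurable G ∧ ∀ k : ℕ, Q.real {ω | G ω = k + 1} = (1 - p) ^ k * p

end ParetoRecords

/-! Almost surely no coordinates tie, so `K` depends only on the order of each coordinate. The two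
orders are independent and uniform, so for bounded `φ` the mean of `φ` of the number killed by the
last point, on the event that it is a record, is `weightSum` divided by `(n + 1) * (n + 1)!`
(`integral_weight`). Here `weightSum` adds over all permutation diagrams and all their minimal
points: the last point in time sits at a uniform place of a uniform diagram.

The diagram grows by adding a rightmost point at a uniform height `p`. That point dominates nothing.
It is minimal only if `p = 0`; it is killed by another point only if `p = 1`, and then by the lowest
one. Hence the number killed by the lowest point is a Markov chain: reset to 0, increased by 1, or
kept, the first two with equal probability. The geometric law is stationary for it, and the chain
converges to that law at rate `1 / n` (`abs_bottomSum_sub_le`). Fed into the recursion for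
`weightSum`, this gives `weightSum / n! = H_n * geomMean φ + O(1)`, with exactly `H_n` for `φ = 1`.
Since `H_n → ∞`, the ratio tends to `geomMean φ`. -/

namespace ParetoRecords

/-! ### Minimal points and killed points of a planar configuration -/

section Weight

variable {ι α β : Type*} [LinearOrder α] [LinearOrder β]

/-- The point with coordinates `(a i, b i)` is not dominated by any other point. -/
def IsMinimal (a : ι → α) (b : ι → β) (i : ι) : Prop :=
  ∀ j, ¬ (a j < a i ∧ b j < b i)

open Classical in
/-- The points dominated by the `i`-th point and by no other point. -/
noncomputable def killed [Fintype ι] (a : ι → α) (b : ι → β) (i : ι) : Finset ι :=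
  Finset.univ.filter fun j =>
    (a i < a j ∧ b i < b j) ∧ ∀ l, a l < a j ∧ b l < b j → l = i

open Classical in
/-- The function `φ` of the number of points killed by the `i`-th point, provided that the
latter is minimal. -/
noncomputable def weight [Fintype ι] (φ : ℕ → ℝ) (a : ι → α) (b : ι → β) (i : ι) : ℝ :=
  if IsMinimal a b i then φ (killed a b i).card else 0

lemma mem_killed [Fintype ι] {a : ι → α} {b : ι → β} {i j : ι} :
    j ∈ killed a b i ↔
      (a i < a j ∧ b i < b j) ∧ ∀ l, a l < a j ∧ b l < b j → l = i := by
  simp [killed]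

lemma weight_congr [Fintype ι] {α' β' : Type*} [LinearOrder α'] [LinearOrder β'] (φ : ℕ → ℝ)
    {a : ι → α} {b : ι → β} {a' : ι → α'} {b' : ι → β'}
    (ha : ∀ i j, a i < a j ↔ a' i < a' j) (hb : ∀ i j, b i < b j ↔ b' i < b' j) (i : ι) :
    weight φ a b i = weight φ a' b' i := by
  have h : killed a b i = killed a' b' i := by
    ext j; simp only [mem_killed, ha, hb]
  have h' : IsMinimal a b i ↔ IsMinimal a' b' i := by
    simp only [IsMinimal, ha, hb]
  classical
  rw [weight, weight, h, if_congr h' rfl rfl]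

/-- Relabelling the points changes nothing but the label of the chosen point. -/
lemma weight_comp [Fintype ι] (φ : ℕ → ℝ) (a : ι → α) (b : ι → β) (ρ : Equiv.Perm ι) (i : ι) :
    weight φ (a ∘ ρ) (b ∘ ρ) i = weight φ a b (ρ i) := by
  have h : (killed (a ∘ ρ) (b ∘ ρ) i).map ρ.toEmbedding = killed a b (ρ i) := by
    ext j
    simp only [Finset.mem_map_equiv, mem_killed, Function.comp_apply, Equiv.apply_symm_apply]
    refine and_congr_right fun _ => ?_
    rw [← ρ.forall_congr_right (q := fun l => a l < a j ∧ b l < b j → l = ρ i)]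
    simp
  have h' : IsMinimal (a ∘ ρ) (b ∘ ρ) i ↔ IsMinimal a b (ρ i) := by
    unfold IsMinimal
    rw [← ρ.forall_congr_right (q := fun j => ¬ (a j < a (ρ i) ∧ b j < b (ρ i)))]
    rfl
  classical
  rw [weight, weight, if_congr h' rfl rfl, ← h, Finset.card_map]

end Weight

/-! ### Adding a rightmost point to a permutation diagram -/

section Insertion

variable {n : ℕ}

/-- The permutation of `Fin (n + 1)` which takes the value `p` at the last place, and whose
other values are in the same relative order as those of `σ`. -/
def insertLast (p : Fin (n + 1)) (σ : Equiv.Perm (Fin n)) : Equiv.Perm (Fin (n + 1)) :=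
  finSuccEquivLast.trans (σ.optionCongr.trans (finSuccEquiv' p).symm)

@[simp] lemma insertLast_last (p : Fin (n + 1)) (σ : Equiv.Perm (Fin n)) :
    insertLast p σ (Fin.last n) = p := by
  simp [insertLast]

@[simp] lemma insertLast_castSucc (p : Fin (n + 1)) (σ : Equiv.Perm (Fin n)) (i : Fin n) :
    insertLast p σ i.castSucc = p.succAbove (σ i) := by
  simp [insertLast]

lemma insertLast_bijective :
    Function.Bijective fun q : Fin (n + 1) × Equiv.Perm (Fin n) => insertLast q.1 q.2 := by
  rw [Fintype.bijective_iff_injective_and_card]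
  constructor
  · rintro ⟨p, σ⟩ ⟨q, τ⟩ h
    have hp : p = q := by
      simpa using congrArg (fun f : Equiv.Perm (Fin (n + 1)) => f (Fin.last n)) h
    subst hp
    have hσ : σ = τ := by
      ext i : 1
      have := congrArg (fun f : Equiv.Perm (Fin (n + 1)) => f i.castSucc) h
      simpa using this
    rw [hσ]
  · simp [Fintype.card_perm, Nat.factorial_succ]

lemma sum_perm_succ (f : Equiv.Perm (Fin (n + 1)) → ℝ) :
    ∑ τ, f τ = ∑ p : Fin (n + 1), ∑ σ : Equiv.Perm (Fin n), f (insertLast p σ) := by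
  rw [← Fintype.sum_prod_type']
  exact (Fintype.sum_bijective _ insertLast_bijective _ _ fun _ => rfl).symm

lemma isMinimal_insertLast_castSucc (p : Fin (n + 1)) (σ : Equiv.Perm (Fin n)) (i : Fin n) :
    IsMinimal id (insertLast p σ) i.castSucc ↔ IsMinimal id σ i := by
  simp [IsMinimal, Fin.forall_fin_succ', Fin.le_last]

lemma isMinimal_insertLast_last (p : Fin (n + 1)) (σ : Equiv.Perm (Fin n)) :
    IsMinimal id (insertLast p σ) (Fin.last n) ↔ p = 0 := by
  constructor
  · intro h
    obtain ⟨j, hj⟩ := (insertLast p σ).surjective 0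
    have := h j
    rw [hj, insertLast_last] at this
    by_contra hp
    refine this ⟨?_, Fin.pos_of_ne_zero hp⟩
    refine Fin.lt_last_iff_ne_last.2 ?_
    rintro rfl
    exact hp (by simpa using hj)
  · rintro rfl j ⟨-, h⟩
    simp at h

lemma killed_insertLast_last (p : Fin (n + 1)) (σ : Equiv.Perm (Fin n)) :
    killed id (insertLast p σ) (Fin.last n) = ∅ := by
  ext j
  simp [mem_killed, Fin.le_last]

/-- Every other point lies to the left of the new one, so the points dominating it are those of
value below `p`. There are `p` of them, and a sole dominator forces `p = 1`. -/
lemma last_mem_killed_insertLast (p : Fin (n + 1)) (σ : Equiv.Perm (Fin n)) (i : Fin n) :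
    Fin.last n ∈ killed id (insertLast p σ) i.castSucc ↔
      (p : ℕ) = 1 ∧ (σ i : ℕ) = 0 := by
  have key : Fin.last n ∈ killed id (insertLast p σ) i.castSucc ↔
      (σ i : ℕ) < p ∧ ∀ l, (σ l : ℕ) < p → l = i := by
    have h (l : Fin n) : p.succAbove (σ l) < p ↔ (σ l : ℕ) < p := by
      rw [Fin.succAbove_lt_iff_castSucc_lt, Fin.lt_def, Fin.val_castSucc]
    simp [mem_killed, Fin.forall_fin_succ', h]
  rw [key]
  constructor
  · rintro ⟨h1, h2⟩
    have hp := p.isLt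
    have hi := (σ i).isLt
    obtain ⟨l, hl⟩ := σ.surjective ⟨0, by omega⟩
    have hli := h2 l (by rw [hl]; simp only; omega)
    subst hli
    have h0 : (σ l : ℕ) = 0 := by rw [hl]
    refine ⟨?_, h0⟩
    -- If `p ≥ 2`, the point of value 1 would be a second dominator.
    by_contra hne
    obtain ⟨l', hl'⟩ := σ.surjective ⟨1, by omega⟩
    have hli' := h2 l' (by rw [hl']; simp only; omega)
    subst hli'
    rw [hl'] at h0
    simp at h0
  · rintro ⟨h1, h2⟩
    refine ⟨by omega, fun l hl => σ.injective (Fin.ext (by omega))⟩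

lemma card_killed_insertLast_castSucc (p : Fin (n + 1)) (σ : Equiv.Perm (Fin n)) (i : Fin n) :
    (killed id (insertLast p σ) i.castSucc).card =
      (killed id σ i).card + if (p : ℕ) = 1 ∧ (σ i : ℕ) = 0 then 1 else 0 := by
  have h (j : Fin n) : j.castSucc ∈ killed id (insertLast p σ) i.castSucc ↔
      j ∈ killed id σ i := by
    simp [mem_killed, Fin.forall_fin_succ', Fin.succAbove_lt_succAbove_iff, Fin.le_last]
  have hcard {m : ℕ} (s : Finset (Fin m)) : s.card = ∑ j, if j ∈ s then 1 else 0 := by simp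
  rw [hcard, hcard, Fin.sum_univ_castSucc]
  simp only [h, last_mem_killed_insertLast]

lemma weight_insertLast_last (φ : ℕ → ℝ) (p : Fin (n + 1)) (σ : Equiv.Perm (Fin n)) :
    weight φ id (insertLast p σ) (Fin.last n) = if p = 0 then φ 0 else 0 := by
  classical
  rw [weight, if_congr (isMinimal_insertLast_last p σ) rfl rfl, killed_insertLast_last]
  simp

lemma weight_insertLast_castSucc (φ : ℕ → ℝ) (p : Fin (n + 1)) (σ : Equiv.Perm (Fin n))
    (i : Fin n) :
    weight φ id (insertLast p σ) i.castSucc = weight φ id σ i +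
      (if (p : ℕ) = 1 then 1 else 0) * (if (σ i : ℕ) = 0 then
        weight (fun k => φ (k + 1)) id σ i - weight φ id σ i else 0) := by
  classical
  rw [weight, if_congr (isMinimal_insertLast_castSucc p σ i) rfl rfl,
    card_killed_insertLast_castSucc]
  unfold weight
  by_cases h1 : (p : ℕ) = 1 <;> by_cases h2 : (σ i : ℕ) = 0 <;>
    by_cases h3 : IsMinimal id σ i <;> simp [h1, h2, h3]

/-- The sum of `weight φ` over all permutations and all places. -/
noncomputable def weightSum (n : ℕ) (φ : ℕ → ℝ) : ℝ :=
  ∑ τ : Equiv.Perm (Fin n), ∑ i, weight φ id τ i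

/-- The sum over all permutations of `weight φ` at the place of the smallest value. -/
noncomputable def bottomSum (n : ℕ) (φ : ℕ → ℝ) : ℝ :=
  ∑ τ : Equiv.Perm (Fin n), ∑ i, if (τ i : ℕ) = 0 then weight φ id τ i else 0

lemma sum_boole_val_eq_one (n : ℕ) :
    ∑ p : Fin (n + 2), (if (p : ℕ) = 1 then (1 : ℝ) else 0) = 1 := by
  rw [Finset.sum_eq_single (1 : Fin (n + 2))]
  · simp
  · intro p _ hp
    rw [if_neg]
    intro h
    exact hp (Fin.ext (by simpa using h))
  · simp

/-- Old points keep their weight for each of the `n + 2` heights, except that at `p = 1` the lowest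
one kills one more. At `p = 0` the new point contributes `φ 0` for each of the `(n + 1)!` old
permutations. -/
lemma weightSum_succ (n : ℕ) (φ : ℕ → ℝ) :
    weightSum (n + 2) φ = (n + 2) * weightSum (n + 1) φ +
      bottomSum (n + 1) (fun k => φ (k + 1)) - bottomSum (n + 1) φ +
        (n + 1).factorial * φ 0 := by
  have h (p : Fin (n + 2)) : ∑ σ : Equiv.Perm (Fin (n + 1)), ∑ i, weight φ id (insertLast p σ) i =
      weightSum (n + 1) φ + (if (p : ℕ) = 1 then 1 else 0) *
        (bottomSum (n + 1) (fun k => φ (k + 1)) - bottomSum (n + 1) φ) +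
        if p = 0 then (n + 1).factorial * φ 0 else 0 := by
    simp only [Fin.sum_univ_castSucc (n := n + 1), weight_insertLast_castSucc,
      weight_insertLast_last, Finset.sum_add_distrib, ← Finset.mul_sum, weightSum, bottomSum,
      ← Finset.sum_sub_distrib, Finset.sum_const, Finset.card_univ, Fintype.card_perm,
      Fintype.card_fin, nsmul_eq_mul]
    congr 1
    · congr 2
      refine Finset.sum_congr rfl fun σ _ => Finset.sum_congr rfl fun i _ => ?_
      split_ifs <;> simp
    · simp
  rw [weightSum, sum_perm_succ]
  simp only [h, Finset.sum_add_distrib, ← Finset.sum_mul, sum_boole_val_eq_one]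
  simp
  ring

/-- The old lowest point stays lowest for the `n + 1` heights `p ≠ 0`, with one more kill if `p =
1`. At `p = 0` the new point replaces it and kills nothing. -/
lemma bottomSum_succ (n : ℕ) (φ : ℕ → ℝ) :
    bottomSum (n + 2) φ = (n + 1) * bottomSum (n + 1) φ +
      bottomSum (n + 1) (fun k => φ (k + 1)) - bottomSum (n + 1) φ +
        (n + 1).factorial * φ 0 := by
  have hw (p : Fin (n + 2)) (σ : Equiv.Perm (Fin (n + 1))) (i : Fin (n + 1)) :
      (if (insertLast p σ i.castSucc : ℕ) = 0 then weight φ id (insertLast p σ) i.castSucc else 0)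
      = (if p = 0 then 0 else 1) * (if (σ i : ℕ) = 0 then weight φ id σ i else 0) +
      (if (p : ℕ) = 1 then 1 else 0) * ((if (σ i : ℕ) = 0 then
        weight (fun k => φ (k + 1)) id σ i else 0) -
        (if (σ i : ℕ) = 0 then weight φ id σ i else 0)) := by
    rw [weight_insertLast_castSucc, insertLast_castSucc]
    by_cases hp : p = 0
    · subst hp; simp
    · have hz : (p.succAbove (σ i) : ℕ) = 0 ↔ (σ i : ℕ) = 0 := by
        rw [Fin.val_eq_zero_iff, Fin.val_eq_zero_iff, Fin.succAbove_eq_zero_iff hp]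
      simp only [hz, hp, if_false]
      split_ifs <;> simp
  have hl (p : Fin (n + 2)) (σ : Equiv.Perm (Fin (n + 1))) :
      (if (insertLast p σ (Fin.last (n + 1)) : ℕ) = 0 then
        weight φ id (insertLast p σ) (Fin.last (n + 1)) else 0) = if p = 0 then φ 0 else 0 := by
    rw [weight_insertLast_last, insertLast_last]
    by_cases hp : p = 0 <;> simp [hp]
  have h (p : Fin (n + 2)) : ∑ σ : Equiv.Perm (Fin (n + 1)), ∑ i,
      (if (insertLast p σ i : ℕ) = 0 then weight φ id (insertLast p σ) i else 0) =
      (if p = 0 then 0 else 1) * bottomSum (n + 1) φ + (if (p : ℕ) = 1 then 1 else 0) *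
        (bottomSum (n + 1) (fun k => φ (k + 1)) - bottomSum (n + 1) φ) +
        if p = 0 then (n + 1).factorial * φ 0 else 0 := by
    simp only [Fin.sum_univ_castSucc (n := n + 1), hw, hl,
      Finset.sum_add_distrib, ← Finset.mul_sum, bottomSum,
      Finset.sum_sub_distrib, Finset.sum_const, Finset.card_univ, Fintype.card_perm,
      Fintype.card_fin, nsmul_eq_mul]
    simp
  have h0 : ∑ p : Fin (n + 2), (if p = 0 then (0 : ℝ) else 1) = n + 1 := by
    simp [Fin.sum_univ_succ]
  rw [bottomSum, sum_perm_succ]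
  simp only [h, Finset.sum_add_distrib, ← Finset.sum_mul, sum_boole_val_eq_one, h0]
  simp
  ring

lemma weightSum_one (φ : ℕ → ℝ) : weightSum 1 φ = φ 0 := by
  simp [weightSum, weight, IsMinimal, killed, Finset.filter_singleton]

lemma bottomSum_one (φ : ℕ → ℝ) : bottomSum 1 φ = φ 0 := by
  simp [bottomSum, weight, IsMinimal, killed, Finset.filter_singleton]

end Insertion

/-! ### Asymptotics of the recursions -/

section Asymptotics

/-- The mean of `φ` under the law giving mass `2 ^ (-(k + 1))` to `k`. -/
noncomputable def geomMean (φ : ℕ → ℝ) : ℝ := ∑' k, (1 / 2 : ℝ) ^ (k + 1) * φ k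

lemma summable_geomMean {φ : ℕ → ℝ} {C : ℝ} (hφ : ∀ k, |φ k| ≤ C) :
    Summable fun k => (1 / 2 : ℝ) ^ (k + 1) * φ k := by
  have h : Summable fun k : ℕ => (1 / 2 : ℝ) ^ (k + 1) * C :=
    ((summable_nat_add_iff 1).2 summable_geometric_two).mul_right C
  refine h.of_norm_bounded fun k => ?_
  rw [norm_mul, Real.norm_eq_abs (φ k), Real.norm_of_nonneg (by positivity)]
  gcongr
  exact hφ k

/-- This is the stationarity equation: it makes `geomMean` a fixed point of the normalised recursion
for `bottomSum`. -/
lemma geomMean_eq {φ : ℕ → ℝ} {C : ℝ} (hφ : ∀ k, |φ k| ≤ C) :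
    2 * geomMean φ = φ 0 + geomMean fun k => φ (k + 1) := by
  rw [geomMean, (summable_geomMean hφ).tsum_eq_zero_add, geomMean, mul_add, ← tsum_mul_left]
  congr 1
  · simp
  · congr! 2 with k
    ring

lemma abs_geomMean_le {φ : ℕ → ℝ} {C : ℝ} (hφ : ∀ k, |φ k| ≤ C) : |geomMean φ| ≤ C := by
  have h1 : HasSum (fun k : ℕ => (1 / 2 : ℝ) ^ (k + 1) * C) C := by
    have := (hasSum_geometric_two.mul_left (1 / 2)).mul_right C
    simpa [pow_succ'] using this
  rw [← Real.norm_eq_abs]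
  refine tsum_of_norm_bounded h1 fun k => ?_
  rw [norm_mul, Real.norm_eq_abs (φ k), Real.norm_of_nonneg (by positivity)]
  gcongr
  exact hφ k

/-- The induction runs over all `φ` with bound `C` at once, because the recursion calls on the
shifted function. -/
lemma abs_bottomSum_sub_le {C : ℝ} (n : ℕ) : ∀ {φ : ℕ → ℝ}, (∀ k, |φ k| ≤ C) →
    |bottomSum (n + 1) φ / (n + 1).factorial - geomMean φ| ≤ 2 * C / (n + 1) := by
  induction n with
  | zero =>
    intro φ hφ
    have h1 := abs_le.1 (hφ 0)
    have h2 := abs_le.1 (abs_geomMean_le hφ)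
    simp only [zero_add, bottomSum_one, Nat.factorial_one, Nat.cast_one, div_one, Nat.cast_zero]
    rw [abs_le]
    constructor <;> linarith
  | succ n ih =>
    intro φ hφ
    have hpos : (0 : ℝ) < n + 1 := by positivity
    have hf : ((n + 1).factorial : ℝ) ≠ 0 := by positivity
    have h1 := ih hφ
    have h2 := ih (φ := fun k => φ (k + 1)) fun k => hφ (k + 1)
    set D := bottomSum (n + 1) φ / (n + 1).factorial - geomMean φ with hD
    set D' := bottomSum (n + 1) (fun k => φ (k + 1)) / (n + 1).factorial -
      geomMean fun k => φ (k + 1) with hD'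
    -- By stationarity the errors obey the recursion without the source term `φ 0`. The weights `n`
    -- and 1 sum to `n + 1`, which cancels the denominator of the inductive bound.
    have key : bottomSum (n + 1 + 1) φ / (n + 1 + 1).factorial - geomMean φ =
        (n * D + D') / (n + 2) := by
      have h3 := geomMean_eq hφ
      have hg : (geomMean fun k => φ (k + 1)) = 2 * geomMean φ - φ 0 := by linarith
      rw [bottomSum_succ, Nat.factorial_succ (n + 1), hD, hD', hg]
      push_cast
      field_simp
      ring
    rw [key, abs_div, abs_of_pos (by positivity : (0 : ℝ) < n + 2)]
    push_cast
    rw [show (n : ℝ) + 1 + 1 = n + 2 by ring]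
    gcongr
    calc |n * D + D'| ≤ |n * D| + |D'| := abs_add_le _ _
      _ = n * |D| + |D'| := by rw [abs_mul, abs_of_nonneg (Nat.cast_nonneg n)]
      _ ≤ n * (2 * C / (n + 1)) + 2 * C / (n + 1) := by gcongr
      _ = 2 * C := by field_simp

/-- For constant `φ` the two `bottomSum` terms cancel, and each insertion adds the probability that
the new point is minimal. -/
lemma weightSum_one_eq_harmonic (n : ℕ) :
    weightSum (n + 1) (fun _ => 1) / (n + 1).factorial = harmonic (n + 1) := by
  induction n with
  | zero => simp [weightSum_one]
  | succ n ih =>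
    have hf : ((n + 1).factorial : ℝ) ≠ 0 := by positivity
    rw [harmonic_succ, Rat.cast_add, ← ih, weightSum_succ, Nat.factorial_succ (n + 1)]
    push_cast
    field_simp
    ring

/-- The increments of the error are at most `4 * C / ((n + 1) * (n + 2))`, which telescopes; 6 makes
the bound equal to `2 * C` at `n = 0`. -/
lemma abs_weightSum_sub_le {C : ℝ} {φ : ℕ → ℝ} (hφ : ∀ k, |φ k| ≤ C) (n : ℕ) :
    |weightSum (n + 1) φ / (n + 1).factorial - harmonic (n + 1) * geomMean φ| ≤
      6 * C - 4 * C / (n + 1) := by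
  induction n with
  | zero =>
    have h1 := abs_le.1 (hφ 0)
    have h2 := abs_le.1 (abs_geomMean_le hφ)
    simp only [zero_add, weightSum_one, Nat.factorial_one, Nat.cast_one, div_one, Nat.cast_zero]
    rw [abs_le]
    constructor <;> simp <;> linarith
  | succ n ih =>
    have hf : ((n + 1).factorial : ℝ) ≠ 0 := by positivity
    have h1 := abs_bottomSum_sub_le n hφ
    have h2 := abs_bottomSum_sub_le n (φ := fun k => φ (k + 1)) fun k => hφ (k + 1)
    set D := bottomSum (n + 1) φ / (n + 1).factorial - geomMean φ with hD
    set D' := bottomSum (n + 1) (fun k => φ (k + 1)) / (n + 1).factorial -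
      geomMean fun k => φ (k + 1) with hD'
    have key : weightSum (n + 1 + 1) φ / (n + 1 + 1).factorial -
        harmonic (n + 1 + 1) * geomMean φ =
        weightSum (n + 1) φ / (n + 1).factorial - harmonic (n + 1) * geomMean φ +
          (D' - D) / (n + 2) := by
      have h3 := geomMean_eq hφ
      have hg : (geomMean fun k => φ (k + 1)) = 2 * geomMean φ - φ 0 := by linarith
      rw [weightSum_succ, harmonic_succ, Nat.factorial_succ (n + 1), hD, hD', hg]
      push_cast
      field_simp
      ring
    rw [key]
    refine (abs_add_le _ _).trans ?_
    have h4 : |(D' - D) / (n + 2)| ≤ (2 * C / (n + 1) + 2 * C / (n + 1)) / (n + 2) := by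
      rw [abs_div, abs_of_pos (by positivity : (0 : ℝ) < n + 2)]
      gcongr
      exact (abs_sub _ _).trans (add_le_add h2 h1)
    refine (add_le_add ih h4).trans (le_of_eq ?_)
    push_cast
    field_simp
    ring

lemma tendsto_harmonic_atTop : Tendsto (fun n => (harmonic n : ℝ)) atTop atTop := by
  refine tendsto_atTop_mono (fun n => log_add_one_le_harmonic n) ?_
  exact Real.tendsto_log_atTop.comp (tendsto_natCast_atTop_atTop.comp (tendsto_add_atTop_nat 1))

theorem tendsto_weightSum_div {C : ℝ} {φ : ℕ → ℝ} (hφ : ∀ k, |φ k| ≤ C) :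
    Tendsto (fun n => weightSum (n + 1) φ / weightSum (n + 1) fun _ => 1) atTop
      (𝓝 (geomMean φ)) := by
  have hC : 0 ≤ C := (abs_nonneg _).trans (hφ 0)
  have hH : Tendsto (fun n => (harmonic (n + 1) : ℝ)) atTop atTop :=
    tendsto_harmonic_atTop.comp (tendsto_add_atTop_nat 1)
  rw [tendsto_iff_norm_sub_tendsto_zero]
  refine squeeze_zero (fun _ => norm_nonneg _) (fun n => ?_) (hH.const_div_atTop (6 * C))
  have hpos : (0 : ℝ) < harmonic (n + 1) := by exact_mod_cast harmonic_pos n.succ_ne_zero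
  have hf : ((n + 1).factorial : ℝ) ≠ 0 := by positivity
  have h1 : (weightSum (n + 1) fun _ => 1) = harmonic (n + 1) * (n + 1).factorial := by
    rw [← weightSum_one_eq_harmonic]
    field_simp
  have h2 : weightSum (n + 1) φ / (weightSum (n + 1) fun _ => 1) - geomMean φ =
      (weightSum (n + 1) φ / (n + 1).factorial - harmonic (n + 1) * geomMean φ) /
        harmonic (n + 1) := by
    rw [h1]
    field_simp
  rw [h2, Real.norm_eq_abs, abs_div, abs_of_pos hpos]
  gcongr
  refine (abs_weightSum_sub_le hφ n).trans (sub_le_self _ ?_)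
  positivity

end Asymptotics

/-! ### Reduction to permutations by exchangeability -/

section Averaging

variable {n : ℕ}

lemma exists_perm_lt_iff {a : Fin n → ℝ} (ha : Function.Injective a) :
    ∃ ρ : Equiv.Perm (Fin n), ∀ i j, a i < a j ↔ ρ i < ρ j := by
  have hs : StrictMono (a ∘ Tuple.sort a) :=
    (Tuple.monotone_sort a).strictMono_of_injective (ha.comp (Tuple.sort a).injective)
  refine ⟨(Tuple.sort a).symm, fun i j => ?_⟩
  rw [← hs.lt_iff_lt]
  simp

lemma sum_perm_apply (h : Fin (n + 1) → ℝ) (i : Fin (n + 1)) :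
    (n + 1) * ∑ σ : Equiv.Perm (Fin (n + 1)), h (σ i) = (n + 1).factorial * ∑ j, h j := by
  have h1 (j : Fin (n + 1)) : ∑ σ : Equiv.Perm (Fin (n + 1)), h (σ j) =
      ∑ σ : Equiv.Perm (Fin (n + 1)), h (σ i) := by
    rw [← Equiv.sum_comp (Equiv.mulRight (Equiv.swap i j))]
    simp
  calc (n + 1) * ∑ σ : Equiv.Perm (Fin (n + 1)), h (σ i)
      = ∑ j, ∑ σ : Equiv.Perm (Fin (n + 1)), h (σ j) := by simp [h1]
    _ = ∑ σ : Equiv.Perm (Fin (n + 1)), ∑ j, h (σ j) := Finset.sum_comm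
    _ = _ := by simp [Equiv.sum_comp, Fintype.card_perm]

lemma sum_weight_perm (φ : ℕ → ℝ) (i : Fin (n + 1)) :
    (n + 1) * ∑ σ : Equiv.Perm (Fin (n + 1)), ∑ τ : Equiv.Perm (Fin (n + 1)), weight φ σ τ i =
      (n + 1).factorial * weightSum (n + 1) φ := by
  have h1 (σ : Equiv.Perm (Fin (n + 1))) :
      ∑ τ : Equiv.Perm (Fin (n + 1)), weight φ σ τ i =
        ∑ τ : Equiv.Perm (Fin (n + 1)), weight φ id τ (σ i) := by
    -- Replacing `τ` by `τ * σ` lists the points by first coordinate; the point `i` then sits at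
    -- place `σ i`.
    rw [← Equiv.sum_comp (Equiv.mulRight σ)]
    refine Finset.sum_congr rfl fun τ _ => ?_
    exact weight_comp φ id τ σ i
  simp only [h1]
  rw [sum_perm_apply fun j => ∑ τ : Equiv.Perm (Fin (n + 1)), weight φ id τ j,
    weightSum, Finset.sum_comm]

lemma sum_weight_comp_perm (φ : ℕ → ℝ) {a b : Fin n → ℝ} (ha : Function.Injective a)
    (hb : Function.Injective b) (i : Fin n) :
    ∑ σ : Equiv.Perm (Fin n), ∑ τ : Equiv.Perm (Fin n), weight φ (a ∘ σ) (b ∘ τ) i =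
      ∑ σ : Equiv.Perm (Fin n), ∑ τ : Equiv.Perm (Fin n), weight φ σ τ i := by
  obtain ⟨ρ, hρ⟩ := exists_perm_lt_iff ha
  obtain ⟨ρ', hρ'⟩ := exists_perm_lt_iff hb
  symm
  rw [← Equiv.sum_comp (Equiv.mulLeft ρ)]
  refine Finset.sum_congr rfl fun σ _ => ?_
  rw [← Equiv.sum_comp (Equiv.mulLeft ρ')]
  refine Finset.sum_congr rfl fun τ _ => ?_
  exact (weight_congr φ (fun i j => hρ (σ i) (σ j)) (fun i j => hρ' (τ i) (τ j)) i).symm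

lemma measurable_isMinimal (i : Fin n) :
    Measurable fun z : (Fin n → ℝ) × (Fin n → ℝ) => IsMinimal z.1 z.2 i := by
  have h1 (i j : Fin n) : Measurable fun z : (Fin n → ℝ) × (Fin n → ℝ) => z.1 i < z.1 j :=
    measurableSet_setOfPred.1 (measurableSet_lt (by fun_prop) (by fun_prop))
  have h2 (i j : Fin n) : Measurable fun z : (Fin n → ℝ) × (Fin n → ℝ) => z.2 i < z.2 j :=
    measurableSet_setOfPred.1 (measurableSet_lt (by fun_prop) (by fun_prop))
  exact Measurable.forall fun j => ((h1 j i).and (h2 j i)).not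

lemma measurable_card_killed (i : Fin n) :
    Measurable fun z : (Fin n → ℝ) × (Fin n → ℝ) => (killed z.1 z.2 i).card := by
  have h1 (i j : Fin n) : Measurable fun z : (Fin n → ℝ) × (Fin n → ℝ) => z.1 i < z.1 j :=
    measurableSet_setOfPred.1 (measurableSet_lt (by fun_prop) (by fun_prop))
  have h2 (i j : Fin n) : Measurable fun z : (Fin n → ℝ) × (Fin n → ℝ) => z.2 i < z.2 j :=
    measurableSet_setOfPred.1 (measurableSet_lt (by fun_prop) (by fun_prop))
  classical
  simp only [killed, Finset.card_filter]
  refine Finset.measurable_sum _ fun j _ => Measurable.ite (measurableSet_setOfPred.2 ?_)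
    measurable_const measurable_const
  exact ((h1 i j).and (h2 i j)).and
    (Measurable.forall fun l => ((h1 l j).and (h2 l j)).imp measurable_const)

lemma measurable_weight (φ : ℕ → ℝ) (i : Fin n) :
    Measurable fun z : (Fin n → ℝ) × (Fin n → ℝ) => weight φ z.1 z.2 i := by
  classical
  exact Measurable.ite (measurableSet_setOfPred.2 (measurable_isMinimal i))
    ((measurable_of_countable φ).comp (measurable_card_killed i)) measurable_const

lemma abs_weight_le {C : ℝ} {φ : ℕ → ℝ} (hφ : ∀ k, |φ k| ≤ C) (a b : Fin n → ℝ) (i : Fin n) :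
    |weight φ a b i| ≤ C := by
  unfold weight
  split_ifs
  · exact hφ _
  · simpa using (abs_nonneg _).trans (hφ 0)

/-- Permuting the two coordinates separately preserves `ν.prod ν`, so the integrand may be averaged
over all pairs of permutations. For injective coordinates this average no longer depends on the
point. -/
theorem integral_weight (ν : Measure (Fin (n + 1) → ℝ)) [IsProbabilityMeasure ν]
    (hν : ∀ σ : Equiv.Perm (Fin (n + 1)), MeasurePreserving (fun a => a ∘ σ) ν ν)
    (hinj : ∀ᵐ a ∂ν, Function.Injective a) {C : ℝ} {φ : ℕ → ℝ} (hφ : ∀ k, |φ k| ≤ C)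
    (i : Fin (n + 1)) :
    ∫ z, weight φ z.1 z.2 i ∂(ν.prod ν) =
      weightSum (n + 1) φ / ((n + 1) * (n + 1).factorial) := by
  set I := ∫ z, weight φ z.1 z.2 i ∂(ν.prod ν) with hI
  have hmp (σ τ : Equiv.Perm (Fin (n + 1))) :
      MeasurePreserving (Prod.map (fun a : Fin (n + 1) → ℝ => a ∘ σ) fun b => b ∘ τ)
        (ν.prod ν) (ν.prod ν) := (hν σ).prod (hν τ)
  have hint (σ τ : Equiv.Perm (Fin (n + 1))) :
      Integrable (fun z => weight φ (z.1 ∘ σ) (z.2 ∘ τ) i) (ν.prod ν) := by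
    refine Integrable.of_bound
      ((measurable_weight φ i).comp (hmp σ τ).measurable).aestronglyMeasurable C
      (.of_forall fun z => ?_)
    exact abs_weight_le hφ _ _ _
  have hcomp (σ τ : Equiv.Perm (Fin (n + 1))) :
      ∫ z, weight φ (z.1 ∘ σ) (z.2 ∘ τ) i ∂(ν.prod ν) = I := by
    rw [hI]
    conv_rhs => rw [← (hmp σ τ).map_eq]
    rw [integral_map (hmp σ τ).measurable.aemeasurable
      (measurable_weight φ i).aestronglyMeasurable]
    rfl
  have hae : ∀ᵐ z ∂(ν.prod ν), ∑ σ : Equiv.Perm (Fin (n + 1)),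
      ∑ τ : Equiv.Perm (Fin (n + 1)), weight φ (z.1 ∘ σ) (z.2 ∘ τ) i =
        ∑ σ : Equiv.Perm (Fin (n + 1)), ∑ τ : Equiv.Perm (Fin (n + 1)), weight φ σ τ i := by
    filter_upwards [Measure.quasiMeasurePreserving_fst.ae hinj,
      Measure.quasiMeasurePreserving_snd.ae hinj] with z h1 h2
    exact sum_weight_comp_perm φ h1 h2 i
  have hsum := integral_congr_ae hae
  rw [integral_finsetSum _ fun σ _ => integrable_finsetSum _ fun τ _ => hint σ τ] at hsum
  simp only [integral_finsetSum _ fun τ _ => hint _ τ, hcomp] at hsum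
  have hw := sum_weight_perm φ i
  have hw' : ((n + 1).factorial : ℝ) * ((n + 1).factorial * I) =
      ∑ σ : Equiv.Perm (Fin (n + 1)), ∑ τ : Equiv.Perm (Fin (n + 1)), weight φ σ τ i := by
    simpa [Fintype.card_perm] using hsum
  rw [← hw'] at hw
  have hf : ((n + 1).factorial : ℝ) ≠ 0 := by positivity
  field_simp
  have := mul_left_cancel₀ hf (hw.symm.trans (mul_left_comm _ _ _))
  linarith

end Averaging

/-! ### The uniform law on the square -/

section Uniform

/-- The uniform distribution on `(0, 1)`. -/
noncomputable def unifMeasure : Measure ℝ := volume.restrict (Set.Ioo 0 1)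

instance : IsProbabilityMeasure unifMeasure := ⟨by simp [unifMeasure]⟩

lemma cond_square_eq :
    ProbabilityTheory.cond (volume : Measure (ℝ × ℝ)) (Set.Ioo (0 : ℝ) 1 ×ˢ Set.Ioo (0 : ℝ) 1) =
      unifMeasure.prod unifMeasure := by
  rw [ProbabilityTheory.cond, unifMeasure, Measure.prod_restrict, ← Measure.volume_eq_prod]
  simp [Measure.volume_eq_prod]

variable {n : ℕ}

lemma measurePreserving_comp_perm (μ : Measure ℝ) [SigmaFinite μ] (σ : Equiv.Perm (Fin n)) :
    MeasurePreserving (fun a : Fin n → ℝ => a ∘ σ) (Measure.pi fun _ => μ)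
      (Measure.pi fun _ => μ) := by
  have h := measurePreserving_piCongrLeft (α := fun _ : Fin n => ℝ) (fun _ => μ) σ.symm
  convert h using 1
  ext a i
  simp [MeasurableEquiv.coe_piCongrLeft, Equiv.piCongrLeft_apply]

lemma ae_injective_pi_unifMeasure :
    ∀ᵐ a ∂(Measure.pi fun _ : Fin n => unifMeasure), Function.Injective a := by
  have hac : (Measure.pi fun _ : Fin n => unifMeasure) ≪ (volume : Measure (Fin n → ℝ)) := by
    rw [show (Measure.pi fun _ : Fin n => unifMeasure) = _ from
      (Measure.restrict_pi_pi (fun _ : Fin n => (volume : Measure ℝ)) fun _ => Set.Ioo 0 1).symm]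
    exact Measure.absolutelyContinuous_of_le Measure.restrict_le_self
  refine hac.ae_le ?_
  have h (i j : Fin n) : ∀ᵐ a : Fin n → ℝ, i ≠ j → a i ≠ a j := by
    by_cases hij : i = j
    · simp [hij]
    -- The set where two given coordinates agree is a proper subspace.
    have h0 : volume (LinearMap.ker (LinearMap.proj (R := ℝ) (φ := fun _ : Fin n => ℝ) i -
        LinearMap.proj j) : Set (Fin n → ℝ)) = 0 := by
      refine Measure.addHaar_submodule _ _ fun htop => ?_
      have : Pi.single i (1 : ℝ) ∈ LinearMap.ker
          (LinearMap.proj (R := ℝ) (φ := fun _ : Fin n => ℝ) i - LinearMap.proj j) := by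
        rw [htop]; trivial
      simp [Ne.symm hij] at this
    filter_upwards [measure_eq_zero_iff_ae_notMem.1 h0] with a ha _ heq
    exact ha (by simp [heq])
  filter_upwards [ae_all_iff.2 fun i => ae_all_iff.2 (h i)] with a ha i j hij
  by_contra hne
  exact ha i j hne hij

end Uniform

/-! ### Records in terms of minimal and killed points -/

section Records

lemma isRecord_succ_iff (x : ℕ → ℝ × ℝ) (n : ℕ) :
    IsRecord x (n + 1) ↔
      IsMinimal (fun i : Fin (n + 1) => (x (i + 1)).1) (fun i => (x (i + 1)).2) (Fin.last n) := by
  constructor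
  · intro h j hj
    by_cases hjn : (j : ℕ) = n
    · simp [hjn] at hj
    · exact h (j + 1) (by omega) (by omega) hj
  · intro h i h1 h2 hd
    obtain ⟨i, rfl⟩ := Nat.exists_eq_add_of_le' h1
    exact h ⟨i, by omega⟩ hd

lemma numKilled_succ (x : ℕ → ℝ × ℝ) (n : ℕ) :
    numKilled x (n + 1) = (killed (fun i : Fin (n + 1) => (x (i + 1)).1)
      (fun i => (x (i + 1)).2) (Fin.last n)).card := by
  symm
  refine Finset.card_bij (fun j _ => (j : ℕ) + 1) ?_ ?_ ?_
  · intro j hj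
    rw [mem_killed] at hj
    have hjn : (j : ℕ) ≠ n := fun h => by simp [h] at hj
    simp only [Finset.mem_filter, Finset.mem_Ico]
    refine ⟨by omega, fun i h1 h2 hd => ?_, fun h => h (n + 1) (by omega) le_rfl hj.1⟩
    obtain ⟨i, rfl⟩ := Nat.exists_eq_add_of_le' h1
    have := congrArg Fin.val (hj.2 ⟨i, by omega⟩ hd)
    simp at this
    omega
  · intro i _ j _ h
    exact Fin.ext (by omega)
  · intro j hj
    simp only [Finset.mem_filter, Finset.mem_Ico] at hj
    obtain ⟨⟨h1, h2⟩, h3, h4⟩ := hj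
    obtain ⟨j, rfl⟩ := Nat.exists_eq_add_of_le' h1
    refine ⟨⟨j, by omega⟩, ?_, rfl⟩
    rw [mem_killed]
    -- A current record at time `n` can be dominated only by the newcomer at time `n + 1`.
    have hlast (i : ℕ) (hi : 1 ≤ i) (hi' : i ≤ n + 1) (hd : Dominates (x i) (x (j + 1))) :
        i = n + 1 := by
      by_contra hne
      exact h3 i hi (by omega) hd
    constructor
    · unfold IsCurrentRecord at h4
      push Not at h4
      obtain ⟨i, hi, hi', hd⟩ := h4
      rw [hlast i hi hi' hd] at hd
      exact hd
    · intro l hd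
      have := hlast (l + 1) (by omega) (by omega) hd
      exact Fin.ext (by simp; omega)

lemma indicator_K_succ (f : ℤ → ℝ) (x : ℕ → ℝ × ℝ) (n : ℕ) :
    (if 0 ≤ K x (n + 1) then f (K x (n + 1)) else 0) =
      weight (fun k => f k) (fun i : Fin (n + 1) => (x (i + 1)).1) (fun i => (x (i + 1)).2)
        (Fin.last n) := by
  by_cases h : IsRecord x (n + 1)
  · rw [weight, if_pos ((isRecord_succ_iff x n).1 h), K, if_pos h, numKilled_succ]
    simp
  · rw [weight, if_neg (mt (isRecord_succ_iff x n).2 h), K, if_neg h]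
    simp

end Records

/-! ### The conditional law of `K` -/

section Law

variable {Ω : Type*} [MeasurableSpace Ω] {P : Measure Ω} [IsProbabilityMeasure P]
  {X : ℕ → Ω → ℝ × ℝ}

/-- The first and the second coordinates of the first `n + 1` observations. -/
def coords (X : ℕ → Ω → ℝ × ℝ) (n : ℕ) (ω : Ω) : (Fin (n + 1) → ℝ) × (Fin (n + 1) → ℝ) :=
  (fun i => (X (i + 1) ω).1, fun i => (X (i + 1) ω).2)

lemma measurable_coords (hmeas : ∀ n, 1 ≤ n → Measurable (X n)) (n : ℕ) :
    Measurable (coords X n) := by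
  have hX (i : Fin (n + 1)) : Measurable (X (i + 1)) := hmeas (i + 1) (by omega)
  exact (measurable_pi_lambda _ fun i => (hX i).fst).prodMk
    (measurable_pi_lambda _ fun i => (hX i).snd)

/-- The square is a product, so the vectors of first and of second coordinates are independent. -/
lemma map_coords (hmeas : ∀ n, 1 ≤ n → Measurable (X n))
    (hunif : ∀ n, 1 ≤ n →
      pdf.IsUniform (X n) (Set.Ioo (0 : ℝ) 1 ×ˢ Set.Ioo (0 : ℝ) 1) P volume)
    (hindep : iIndepFun (fun n : ℕ => X (n + 1)) P) (n : ℕ) :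
    P.map (coords X n) = (Measure.pi fun _ => unifMeasure).prod
      (Measure.pi fun _ => unifMeasure) := by
  have hX (i : Fin (n + 1)) : Measurable (X (i + 1)) := hmeas (i + 1) (by omega)
  have hind : iIndepFun (fun i : Fin (n + 1) => X (i + 1)) P :=
    hindep.precomp Fin.val_injective
  have h1 := (iIndepFun_iff_map_fun_eq_pi_map fun i => (hX i).aemeasurable).1 hind
  have h2 (i : Fin (n + 1)) : P.map (X (i + 1)) = unifMeasure.prod unifMeasure :=
    (hunif (i + 1) (by omega)).trans cond_square_eq
  simp only [h2] at h1
  rw [← (measurePreserving_arrowProdEquivProdArrow ℝ ℝ (Fin (n + 1)) (fun _ => unifMeasure)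
    fun _ => unifMeasure).map_eq, ← h1, Measure.map_map (MeasurableEquiv.measurable _)
    (measurable_pi_lambda _ hX)]
  rfl

lemma measurable_K (hmeas : ∀ n, 1 ≤ n → Measurable (X n)) (n : ℕ) :
    Measurable fun ω => K (fun i => X i ω) n := by
  classical
  obtain _ | n := n
  · have : (fun ω => K (fun i => X i ω) 0) = fun _ => 0 := by
      ext ω
      simp [K, IsRecord, numKilled]
    rw [this]
    exact measurable_const
  · have : (fun ω => K (fun i => X i ω) (n + 1)) = (fun z => if IsMinimal z.1 z.2 (Fin.last n) then
        ((killed z.1 z.2 (Fin.last n)).card : ℤ) else -1) ∘ coords X n := by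
      ext ω
      rw [Function.comp_apply, coords, K, numKilled_succ]
      exact if_congr (isRecord_succ_iff _ n) rfl rfl
    rw [this]
    exact (Measurable.ite (measurableSet_setOfPred.2 (measurable_isMinimal _))
      ((measurable_of_countable _).comp (measurable_card_killed _)) measurable_const).comp
        (measurable_coords hmeas n)

lemma setIntegral_K (hmeas : ∀ n, 1 ≤ n → Measurable (X n))
    (hunif : ∀ n, 1 ≤ n →
      pdf.IsUniform (X n) (Set.Ioo (0 : ℝ) 1 ×ˢ Set.Ioo (0 : ℝ) 1) P volume)
    (hindep : iIndepFun (fun n : ℕ => X (n + 1)) P) (n : ℕ) {C : ℝ} {f : ℤ → ℝ}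
    (hf : ∀ k, |f k| ≤ C) :
    ∫ ω in {ω | 0 ≤ K (fun i => X i ω) (n + 1)}, f (K (fun i => X i ω) (n + 1)) ∂P =
      weightSum (n + 1) (fun k => f k) / ((n + 1) * (n + 1).factorial) := by
  have hs : MeasurableSet {ω | 0 ≤ K (fun i => X i ω) (n + 1)} :=
    measurableSet_le measurable_const (measurable_K hmeas _)
  rw [← integral_indicator hs]
  have h : Set.indicator {ω | 0 ≤ K (fun i => X i ω) (n + 1)}
      (fun ω => f (K (fun i => X i ω) (n + 1))) =
        fun ω => weight (fun k => f k) (coords X n ω).1 (coords X n ω).2 (Fin.last n) := by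
    ext ω
    rw [Set.indicator_apply]
    exact indicator_K_succ f (fun i => X i ω) n
  rw [h, ← integral_map (f := fun z => weight (fun k => f k) z.1 z.2 (Fin.last n))
    (measurable_coords hmeas n).aemeasurable (measurable_weight _ _).aestronglyMeasurable,
    map_coords hmeas hunif hindep]
  exact integral_weight _ (measurePreserving_comp_perm _) ae_injective_pi_unifMeasure
    (fun k => hf k) _

lemma measureReal_K_nonneg (hmeas : ∀ n, 1 ≤ n → Measurable (X n))
    (hunif : ∀ n, 1 ≤ n →
      pdf.IsUniform (X n) (Set.Ioo (0 : ℝ) 1 ×ˢ Set.Ioo (0 : ℝ) 1) P volume)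
    (hindep : iIndepFun (fun n : ℕ => X (n + 1)) P) (n : ℕ) :
    P.real {ω | 0 ≤ K (fun i => X i ω) (n + 1)} =
      weightSum (n + 1) (fun _ => 1) / ((n + 1) * (n + 1).factorial) := by
  simpa using setIntegral_K hmeas hunif hindep n (C := 1) (f := fun _ => 1) (by simp)

lemma measure_K_nonneg_ne_zero (hmeas : ∀ n, 1 ≤ n → Measurable (X n))
    (hunif : ∀ n, 1 ≤ n →
      pdf.IsUniform (X n) (Set.Ioo (0 : ℝ) 1 ×ˢ Set.Ioo (0 : ℝ) 1) P volume)
    (hindep : iIndepFun (fun n : ℕ => X (n + 1)) P) (n : ℕ) :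
    P {ω | 0 ≤ K (fun i => X i ω) n} ≠ 0 := by
  obtain _ | n := n
  -- At time 0 the record condition is vacuous, so the event is everything.
  · simp [K, IsRecord]
  · intro h0
    have h := measureReal_K_nonneg hmeas hunif hindep n
    have hH := weightSum_one_eq_harmonic n
    have hpos : (0 : ℝ) < harmonic (n + 1) := by exact_mod_cast harmonic_pos n.succ_ne_zero
    rw [measureReal_def, h0, mul_comm, ← div_div, hH] at h
    have : (0 : ℝ) < harmonic (n + 1) / (n + 1) := by positivity
    rw [← h] at this
    simp at this

lemma integral_cond_K (hmeas : ∀ n, 1 ≤ n → Measurable (X n))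
    (hunif : ∀ n, 1 ≤ n →
      pdf.IsUniform (X n) (Set.Ioo (0 : ℝ) 1 ×ˢ Set.Ioo (0 : ℝ) 1) P volume)
    (hindep : iIndepFun (fun n : ℕ => X (n + 1)) P) (n : ℕ) {C : ℝ} {f : ℤ → ℝ}
    (hf : ∀ k, |f k| ≤ C) :
    ∫ ω, f (K (fun i => X i ω) (n + 1)) ∂(ProbabilityTheory.cond P
        {ω | 0 ≤ K (fun i => X i ω) (n + 1)}) =
      weightSum (n + 1) (fun k => f k) / weightSum (n + 1) fun _ => 1 := by
  have hf' : ((n + 1).factorial : ℝ) ≠ 0 := by positivity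
  rw [ProbabilityTheory.cond, integral_smul_measure, setIntegral_K hmeas hunif hindep n hf,
    ENNReal.toReal_inv, ← measureReal_def, measureReal_K_nonneg hmeas hunif hindep, smul_eq_mul,
    inv_div]
  field_simp

theorem tendsto_integral_cond_K (hmeas : ∀ n, 1 ≤ n → Measurable (X n))
    (hunif : ∀ n, 1 ≤ n →
      pdf.IsUniform (X n) (Set.Ioo (0 : ℝ) 1 ×ˢ Set.Ioo (0 : ℝ) 1) P volume)
    (hindep : iIndepFun (fun n : ℕ => X (n + 1)) P) {C : ℝ} {f : ℤ → ℝ} (hf : ∀ k, |f k| ≤ C) :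
    Tendsto (fun n : ℕ => ∫ ω, f (K (fun i => X i ω) n) ∂(ProbabilityTheory.cond P
      {ω | 0 ≤ K (fun i => X i ω) n})) atTop (𝓝 (geomMean fun k => f k)) := by
  rw [← tendsto_add_atTop_iff_nat 1]
  simp only [integral_cond_K hmeas hunif hindep _ hf]
  exact tendsto_weightSum_div fun k => hf k

end Law

/-! ### The limit law -/

section Geometric

variable {Ω : Type*} [MeasurableSpace Ω] {Q : Measure Ω} [IsProbabilityMeasure Q] {G : Ω → ℕ}

lemma integral_comp_isGeometric (hG : IsGeometric (1 / 2) G Q) {C : ℝ} {g : ℕ → ℝ}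
    (hg : ∀ k, |g k| ≤ C) :
    ∫ ω, g (G ω) ∂Q = Q.real {ω | G ω = 0} * g 0 + geomMean fun k => g (k + 1) := by
  have hm : Measurable G := hG.1
  have : IsProbabilityMeasure (Q.map G) := Measure.isProbabilityMeasure_map hm.aemeasurable
  have hint : Integrable g (Q.map G) :=
    .of_bound (measurable_of_countable g).aestronglyMeasurable C (.of_forall hg)
  have hreal (k : ℕ) : (Q.map G).real {k} = Q.real {ω | G ω = k} :=
    map_measureReal_apply hm (measurableSet_singleton k)
  have hsucc (k : ℕ) : (Q.map G).real {k + 1} = (1 / 2) ^ (k + 1) := by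
    rw [hreal]
    refine (hG.2 k).trans ?_
    norm_num [pow_succ]
  rw [← integral_map (f := g) hm.aemeasurable (measurable_of_countable g).aestronglyMeasurable,
    integral_countable hint]
  simp only [smul_eq_mul]
  rw [((summable_nat_add_iff 1).1 ?_).tsum_eq_zero_add, hreal, geomMean]
  · simp only [hsucc]
  · simp only [hsucc]
    exact summable_geomMean fun k => hg (k + 1)

/-- `IsGeometric` says nothing about the value 0; it has no mass because the other masses already
sum to 1. -/
lemma measureReal_isGeometric_zero (hG : IsGeometric (1 / 2) G Q) :
    Q.real {ω | G ω = 0} = 0 := by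
  have h := integral_comp_isGeometric hG (C := 1) (g := fun _ => 1) (by simp)
  have h1 := geomMean_eq (C := 1) (φ := fun _ => 1) (by simp)
  simp only [integral_const, probReal_univ, smul_eq_mul, mul_one] at h
  linarith

lemma integral_isGeometric_sub_one (hG : IsGeometric (1 / 2) G Q) {C : ℝ} {f : ℤ → ℝ}
    (hf : ∀ k, |f k| ≤ C) :
    ∫ ω, f ((G ω : ℤ) - 1) ∂Q = geomMean fun k => f k := by
  rw [integral_comp_isGeometric hG (g := fun k => f ((k : ℤ) - 1)) fun k => hf _,
    measureReal_isGeometric_zero hG]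
  simp

end Geometric

end ParetoRecords

theorem theoremT {Ω : Type*} [MeasurableSpace Ω] (P : Measure Ω) [IsProbabilityMeasure P]
    (X : ℕ → Ω → ℝ × ℝ)
    (hmeas : ∀ n, 1 ≤ n → Measurable (X n))
    (hunif : ∀ n, 1 ≤ n →
      pdf.IsUniform (X n) (Set.Ioo (0 : ℝ) 1 ×ˢ Set.Ioo (0 : ℝ) 1) P volume)
    (hindep : iIndepFun (fun n : ℕ => X (n + 1)) P)
    {Ω' : Type*} [MeasurableSpace Ω'] (Q : Measure Ω') [IsProbabilityMeasure Q]
    (G : Ω' → ℕ) (hG : ParetoRecords.IsGeometric (1 / 2) G Q) :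
    (∃ _ : ∀ n : ℕ, IsProbabilityMeasure
          (ProbabilityTheory.cond P {ω | 0 ≤ ParetoRecords.K (fun i => X i ω) n}),
      TendstoInDistribution
        (fun (n : ℕ) (ω : Ω) => ParetoRecords.K (fun i => X i ω) n) atTop
        (fun ω' : Ω' => (G ω' : ℤ) - 1)
        (fun n : ℕ => ProbabilityTheory.cond P {ω | 0 ≤ ParetoRecords.K (fun i => X i ω) n})
        Q) ∧
    ∀ k : ℕ, Tendsto
      (fun n : ℕ =>
        (ProbabilityTheory.cond P {ω | 0 ≤ ParetoRecords.K (fun i => X i ω) n}).real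
          {ω | ParetoRecords.K (fun i => X i ω) n = (k : ℤ)})
      atTop (𝓝 ((1 / 2 : ℝ) ^ (k + 1))) := by
  have hne := ParetoRecords.measure_K_nonneg_ne_zero hmeas hunif hindep
  have hprob (n : ℕ) : IsProbabilityMeasure
      (ProbabilityTheory.cond P {ω | 0 ≤ ParetoRecords.K (fun i => X i ω) n}) :=
    cond_isProbabilityMeasure (hne n)
  have hKm := ParetoRecords.measurable_K hmeas
  have hGm : Measurable fun ω' : Ω' => (G ω' : ℤ) - 1 :=
    (measurable_of_countable fun k : ℕ => (k : ℤ) - 1).comp hG.1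
  refine ⟨⟨hprob, fun n => (hKm n).aemeasurable, hGm.aemeasurable, ?_⟩, fun k => ?_⟩
  · refine ProbabilityMeasure.tendsto_iff_forall_integral_tendsto.2 fun f => ?_
    have hf (k : ℤ) : |f k| ≤ ‖f‖ := f.norm_coe_le_norm k
    have hfm : Measurable f := f.continuous.measurable
    change Tendsto (fun n => ∫ z, f z ∂(Measure.map (fun ω => ParetoRecords.K (fun i => X i ω) n)
      (ProbabilityTheory.cond P {ω | 0 ≤ ParetoRecords.K (fun i => X i ω) n}))) atTop
      (𝓝 (∫ z, f z ∂(Q.map fun ω' => (G ω' : ℤ) - 1)))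
    rw [integral_map hGm.aemeasurable hfm.aestronglyMeasurable,
      ParetoRecords.integral_isGeometric_sub_one hG hf]
    simp only [integral_map (hKm _).aemeasurable hfm.aestronglyMeasurable]
    exact ParetoRecords.tendsto_integral_cond_K hmeas hunif hindep hf
  -- The point masses are the case where `f` is the indicator of `k`.
  · have hf (j : ℤ) : |(if j = k then 1 else 0 : ℝ)| ≤ 1 := by split_ifs <;> simp
    have h := ParetoRecords.tendsto_integral_cond_K hmeas hunif hindep hf
    have hlim : (ParetoRecords.geomMean fun j => if (j : ℤ) = k then 1 else 0) =
        (1 / 2 : ℝ) ^ (k + 1) := by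
      rw [ParetoRecords.geomMean, tsum_eq_single k fun j hj => by simp [hj]]
      simp
    rw [hlim] at h
    refine h.congr fun n => ?_
    have hs : MeasurableSet {ω | ParetoRecords.K (fun i => X i ω) n = k} :=
      hKm n (measurableSet_singleton (k : ℤ))
    rw [← integral_indicator_one hs]
    refine integral_congr_ae (.of_forall fun ω => ?_)
    simp [Set.indicator_apply]
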